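/- **Notation.** $(X;p)_n=\prod_{k=0}^{n-1}(1-p^kX)$. For a triple $\boldsymbol n=(n_1,n_2,n_3)$ put $\underline{\boldsymbol n}=n_1+n_2+n_3$, $|\boldsymbol n|^2=n_1^2+n_2^2+n_3^2$, and $n'_a=n_{bc}=\frac12(n_b+n_c-n_a)$ for $\{a,b,c\}=\{1,2,3\}$, so that $n_a=n'_b+n'_c$. A triple $\boldsymbol l\in\mathbb Z_{\ge0}^3$ is *admissible* if $\underline{\boldsymbol l}$ is even and $l_a\le l_b+l_c$ for all $\{a,b,c\}=\{1,2,3\}$. **The polynomial $\phi_{\boldsymbol l}$.** Let $\Psi_q(Y)^{-1}=(-qY;q^2)_\infty=\sum_{n\ge0}\frac{q^{n^2}}{(q^2;q^2)_n}Y^n$. On functions $f$ of $\boldsymbol j'=(j_{23},j_{13},j_{12})\in\mathbb Z^3$ (with $\boldsymbol j$ determined by $\boldsymbol j'$ as above) with values in $\mathbb C(q)((t))\supset\mathbb C(q,t)$ let $(U_{ab}f)(\boldsymbol j')=q^{j_{ab}}f(\boldsymbol j')$, let $V_{ab}$ shift $j_{ab}$ to $j_{ab}-1$, and let the quantum torus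 $q^{(\lambda,\mu)}Y_\lambda Y_\mu=Y_{\lambda+\mu}$ on the span of $e_1,e_3,e_5,e_7$, with $(e_1,e_7)=(e_3,e_7)=(e_5,e_7)=1$ and $(e_i,e_j)=0$ for $i,j\in\{1,3,5\}$, act by $$Y_{e_1}=(\mathbf iV_{23}^{-1}U_{23}^{-1})^2,\quad Y_{e_3}=(\mathbf iV_{13}^{-1}U_{13}^{-1})^2,\quad Y_{e_5}=(\mathbf iV_{12}^{-1}U_{12}^{-1})^2,\quad Y_{e_7}=-qt^{-1}V_{12}V_{13}V_{23}.$$ Put $$\Psi_\gamma=\Psi_q(Y_{-e_1-e_3-e_5-2e_7})\Psi_q(Y_{-e_5-e_7})\Psi_q(Y_{-e_3-e_7})\Psi_q(Y_{-e_1-e_7})\Psi_q(Y_{-e_7}),$$ the series for $\Psi_\gamma^{-1}$ being applied factor by factor and summed pointwise ($t$-adically). For admissible $\boldsymbol l$ let $g_{\boldsymbol l}(\boldsymbol j)=0$ unless $\boldsymbol j\in\mathbb Z_{\ge0}^3$ and $\frac12(\boldsymbol l-\boldsymbol j)\in\mathbb Z_{\ge0}^3$, in which case $$g_{\boldsymbol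 l}(\boldsymbol j)=\Psi_q(-qt^2)\,(q^2t^{-1})^{\frac12(\underline{\boldsymbol j}+\underline{\boldsymbol l})}\prod_{a=1}^3(q^{-2l_a};q^2)_{\frac12(j_a+l_a)}(t^2;q^2)_{\frac12(j_a+l_a)}.$$ With $W_n(x)=\sum_{k=0}^n\frac{(q^2;q^2)_n}{(q^2;q^2)_k(q^2;q^2)_{n-k}}x^{n-2k}$ define the Laurent polynomial $$\phi_{\boldsymbol l}=\sum_{\boldsymbol j'\in\mathbb Z_{\ge0}^3}(\Psi_\gamma^{-1}g_{\boldsymbol l})(\boldsymbol j)\prod_{a<b}\frac{W_{j_{ab}}(x_{ab})}{(q^2;q^2)_{j_{ab}}}.$$ **The lattice sum.** For $\boldsymbol k\in\mathbb Z_{\ge0}^3$ let $\Delta(\boldsymbol k|\boldsymbol l)$ be the set of $(r_{23},r_{13},r_{12},s,n_1,n_2,n_3)\in\mathbb Z_{\ge0}^7$ with $2k_{ab}-l_{ab}\le r_{ab}$ for all $a<b$ and $r_a\le n_a\le k_a-s$ for all $a$, where $r_a=r_{ab}+r_{ac}$ (so $\boldsymbol r'=(r_{23},r_{13},r_{12})$).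 Put $$\begin{aligned}C_{\boldsymbol l,\boldsymbol k}(\boldsymbol r',s,\boldsymbol n)={}&\frac{(-1)^s(q^2t^{-1})^{\underline{\boldsymbol l}+\underline{\boldsymbol r}-\underline{\boldsymbol k}+2s}\,q^{\underline{\boldsymbol n}^2-\underline{\boldsymbol r}^2+3|\boldsymbol r|^2-|\boldsymbol n|^2-2\boldsymbol r\cdot\boldsymbol n+(s+1)(s+2(\underline{\boldsymbol n}-\underline{\boldsymbol r}))}}{(q^2;q^2)_s\,(q^2t^2;q^2)_{\underline{\boldsymbol n}+\frac12\underline{\boldsymbol l}-\underline{\boldsymbol k}+3s}}\\&\times\prod_{a=1}^3q^{2(n_a-r_a)(l'_a-2k'_a)}\frac{(t^2;q^2)_{n_a+l_a-k_a+s}(q^{-2l_a};q^2)_{n_a+l_a-k_a+s}}{(q^2;q^2)_{n_a-r_a}(q^2;q^2)_{r'_a}(q^2;q^2)_{l'_a+r'_a-2k'_a}}\end{aligned}$$ and $$\phi^{\Delta}_{\boldsymbol l}=\sum_{\underline{\boldsymbol k}\le\underline{\boldsymbol l}}\ \sum_{(\boldsymbol r',s,\boldsymbol n)\in\Delta(\boldsymbol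 k|\boldsymbol l)}C_{\boldsymbol l,\boldsymbol k}(\boldsymbol r',s,\boldsymbol n)\prod_{a<b}x_{ab}^{l_{ab}-2k_{ab}}.$$ **Statement.** For every admissible triple $\boldsymbol l$, the polytope $\Delta(0|\boldsymbol l)$ consists of the single point $0$, and the coefficient of the monomial $x_{23}^{l_{23}}x_{13}^{l_{13}}x_{12}^{l_{12}}$ in $\phi_{\boldsymbol l}$, and likewise in $\phi^\Delta_{\boldsymbol l}$, is $$K_0(\boldsymbol l)=\frac{t^{-\underline{\boldsymbol l}}q^{2\underline{\boldsymbol l}}}{(q^2t^2;q^2)_{\frac12\underline{\boldsymbol l}}}\prod_{a=1}^3\frac{(t^2;q^2)_{l_a}(q^{-2l_a};q^2)_{l_a}}{(q^2;q^2)_{l'_a}}\in\mathbb C(q,t).$$ -/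

import Mathlib

noncomputable section

namespace GenusTwo

/-! ### Scalars

`Fq = ℂ(q)`, `Kqt = ℂ(q,t) = ℂ(q)(t)`, and `Lqt = ℂ(q)((t))`, a field that contains `Kqt` and is
complete for the `t`-adic topology, so that the infinite series
(quantum dilogarithms) used below make sense in it. -/

/-- The field `ℂ(q)`. -/
def Fq : Type := RatFunc ℂ

instance : Field Fq := inferInstanceAs (Field (RatFunc ℂ))

/-- The field `ℂ(q,t)`. -/
abbrev Kqt : Type := RatFunc Fq

/-- The field `ℂ(q)((t))`, with its `t`-adic topology. -/
abbrev Lqt : Type := LaurentSeries Fq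

/-- The variable `q` of `ℂ(q)`. -/
def q0 : Fq := (RatFunc.X : RatFunc ℂ)

theorem q0_ne_zero : q0 ≠ 0 := RatFunc.X_ne_zero (K := ℂ)

/-- The imaginary unit of `ℂ(q)`. -/
def i0 : Fq := (RatFunc.C Complex.I : RatFunc ℂ)

theorem i0_sq : i0 ^ 2 = -1 := by
  have h : (RatFunc.C Complex.I : RatFunc ℂ) ^ 2 = -1 := by
    rw [← map_pow, Complex.I_sq, map_neg, map_one]
  exact h

/-- `q` in `ℂ(q,t)`. -/
def qK : Kqt := RatFunc.C q0

/-- `t` in `ℂ(q,t)`. -/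
def tK : Kqt := RatFunc.X

open scoped RatFunc in
/-- The inclusion of `ℂ(q,t)` into `ℂ(q)((t))`. -/
def toL : Kqt →+* Lqt := algebraMap Kqt Lqt

/-- `q` in `ℂ(q)((t))`. -/
def qL : Lqt := HahnSeries.C q0

/-- `t` in `ℂ(q)((t))`. -/
def tL : Lqt := HahnSeries.single 1 1

open scoped RatFunc in
theorem toL_tK : toL tK = tL := RatFunc.coe_X

open scoped RatFunc in
theorem toL_qK : toL qK = qL := by
  have h := IsScalarTower.algebraMap_apply (Polynomial Fq) Kqt Lqt (Polynomial.C q0)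
  rw [RatFunc.algebraMap_C] at h
  rw [toL, qK, ← h]
  simp [qL]

/-- The imaginary unit in `ℂ(q)((t))`. -/
def iL : Lqt := HahnSeries.C i0

/-- The `q`-Pochhammer symbol `(X;p)_n = ∏_{k=0}^{n-1} (1 - p^k X)`. -/
def qPoch {K : Type*} [CommRing K] (X p : K) (n : ℕ) : K :=
  ∏ k ∈ Finset.range n, (1 - p ^ k * X)

/-- The `q`-binomial coefficient. -/
def qBinom {K : Type*} [Field K] (p : K) (n k : ℕ) : K :=
  qPoch p p n / (qPoch p p k * qPoch p p (n - k))

/-! ### Triples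

Triples are indexed by `Fin 3`, with `a = 0, 1, 2` standing for the indices `1, 2, 3`.
For `{a,b,c} = {1,2,3}` an object carrying the pair of indices `bc` sits at position `a`; the
positions `0, 1, 2` thus stand for the pairs `23, 13, 12`. -/

/-- Admissible triples: non-negative, with even sum, satisfying the triangle inequalities. -/
structure Admissible (l : Fin 3 → ℕ) : Prop where
  even_sum : Even (∑ a, l a)
  triangle : ∀ a, l a ≤ l (a + 1) + l (a + 2)

/-- `2 n'_a = 2 n_{bc} = n_b + n_c - n_a`. -/
def twicePrime (n : Fin 3 → ℕ) (a : Fin 3) : ℤ :=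
  (n (a + 1) : ℤ) + n (a + 2) - n a

/-- `n'_a = n_{bc} = (n_b + n_c - n_a) / 2`; the division is exact when the sum of `n` is even. -/
def prime (n : Fin 3 → ℕ) (a : Fin 3) : ℤ := twicePrime n a / 2

/-- The inverse of `n ↦ n'`, that is `n_a = n'_b + n'_c`. -/
def unprime {M : Type*} [Add M] (m : Fin 3 → M) (a : Fin 3) : M := m (a + 1) + m (a + 2)

/-! ### The polytope and the factor `K_0` -/

/-- The lattice points `(r', s, n)` of the polytope `Δ(k|l)`, where `r' = (r_{23}, r_{13}, r_{12})`:
`2 k_{bc} - l_{bc} ≤ r_{bc}` and `r_{ab} + r_{ac} ≤ n_a ≤ k_a - s`. -/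
def Delta (k l : Fin 3 → ℕ) : Set ((Fin 3 → ℕ) × ℕ × (Fin 3 → ℕ)) :=
  {p | (∀ a, twicePrime k a - prime l a ≤ (p.1 a : ℤ)) ∧
    ∀ a, unprime p.1 a ≤ p.2.2 a ∧ (p.2.2 a : ℤ) ≤ (k a : ℤ) - p.2.1}

theorem Delta_finite (k l : Fin 3 → ℕ) : (Delta k l).Finite := by
  refine Set.Finite.subset (Set.Finite.prod (Set.finite_Iic (fun _ => ∑ a, k a))
    (Set.Finite.prod (Set.finite_Iic (∑ a, k a)) (Set.finite_Iic (fun _ => ∑ a, k a)))) ?_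
  rintro ⟨r, s, n⟩ ⟨-, h⟩
  have h0 := h 0
  have h1 := h 1
  have h2 := h 2
  simp only [unprime] at h0 h1 h2
  simp only [Set.mem_prod, Set.mem_Iic, Fin.sum_univ_three, Pi.le_def]
  refine ⟨fun a => ?_, ?_, fun a => ?_⟩
  · fin_cases a <;> simp at * <;> omega
  · simp at *; omega
  · fin_cases a <;> simp at * <;> omega

/-- The rational function
`K_0(l) = t^{-|l|} q^{2|l|} / (q² t²; q²)_{|l|/2} ∏_a (t²;q²)_{l_a} (q^{-2 l_a};q²)_{l_a} / (q²;q²)_{l'_a}`,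
with `|l| = l_1 + l_2 + l_3`. -/
def K0 (l : Fin 3 → ℕ) : Kqt :=
  tK ^ (-((∑ a, l a : ℕ) : ℤ)) * qK ^ (2 * ∑ a, l a)
      / qPoch (qK ^ 2 * tK ^ 2) (qK ^ 2) ((∑ a, l a) / 2) *
    ∏ a, (qPoch (tK ^ 2) (qK ^ 2) (l a) * qPoch (qK ^ (-2 * (l a : ℤ))) (qK ^ 2) (l a)
      / qPoch (qK ^ 2) (qK ^ 2) (prime l a).toNat)

/-! ### The lattice sum -/

/-- The weight `C_{l,k}(r', s, n)`. All subscripts of the Pochhammer symbols are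
non-negative when `(r', s, n)` lies in `Δ(k|l)`. -/
def weight (l k : Fin 3 → ℕ) (r' : Fin 3 → ℕ) (s : ℕ) (n : Fin 3 → ℕ) : Kqt :=
  let r : Fin 3 → ℤ := fun a => (unprime r' a : ℕ)
  let sl : ℤ := ∑ a, (l a : ℤ)
  let sk : ℤ := ∑ a, (k a : ℤ)
  let sn : ℤ := ∑ a, (n a : ℤ)
  let sr : ℤ := ∑ a, r a
  (-1) ^ s * (qK ^ 2 * tK⁻¹) ^ (sl + sr - sk + 2 * (s : ℤ))
      * qK ^ (sn ^ 2 - sr ^ 2 + 3 * (∑ a, r a ^ 2) - (∑ a, (n a : ℤ) ^ 2)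
          - 2 * (∑ a, r a * (n a : ℤ)) + ((s : ℤ) + 1) * ((s : ℤ) + 2 * (sn - sr)))
      / (qPoch (qK ^ 2) (qK ^ 2) s
          * qPoch (qK ^ 2 * tK ^ 2) (qK ^ 2) (sn + sl / 2 - sk + 3 * (s : ℤ)).toNat) *
    ∏ a, (qK ^ (2 * ((n a : ℤ) - r a) * (prime l a - twicePrime k a))
      * (qPoch (tK ^ 2) (qK ^ 2) ((n a : ℤ) + l a - k a + s).toNat
          * qPoch (qK ^ (-2 * (l a : ℤ))) (qK ^ 2) ((n a : ℤ) + l a - k a + s).toNat)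
      / (qPoch (qK ^ 2) (qK ^ 2) ((n a : ℤ) - r a).toNat
          * qPoch (qK ^ 2) (qK ^ 2) (r' a)
          * qPoch (qK ^ 2) (qK ^ 2) (prime l a + (r' a : ℤ) - twicePrime k a).toNat))

/-- The Laurent polynomial in `x_{23}, x_{13}, x_{12}` over `ℂ(q,t)`
`∑_{|k| ≤ |l|} ∑_{(r',s,n) ∈ Δ(k|l)} C_{l,k}(r',s,n) ∏ x_{ab}^{l_{ab} - 2 k_{ab}}`. -/
def phiSum (l : Fin 3 → ℕ) : AddMonoidAlgebra Kqt (Fin 3 → ℤ) :=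
  ∑ᶠ k ∈ {k : Fin 3 → ℕ | ∑ a, k a ≤ ∑ a, l a}, ∑ᶠ p ∈ Delta k l,
    AddMonoidAlgebra.single (fun a => prime l a - twicePrime k a) (weight l k p.1 p.2.1 p.2.2)

/-! ### The quantum dilogarithm -/

/-- The power series `Ψ_q(Y)⁻¹ = (-qY;q²)_∞ = ∑_n q^{n²} Y^n / (q²;q²)_n` over `ℂ(q)`. -/
def dilogInv : PowerSeries Fq :=
  PowerSeries.mk fun n => q0 ^ (n ^ 2) / qPoch (q0 ^ 2) (q0 ^ 2) n

theorem constantCoeff_dilogInv : PowerSeries.constantCoeff dilogInv = 1 := by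
  simp [dilogInv, qPoch, ← PowerSeries.coeff_zero_eq_constantCoeff_apply]

theorem q0_pow_ne_one (n : ℕ) (hn : n ≠ 0) : q0 ^ n ≠ 1 := by
  intro h
  have h' : (RatFunc.X : RatFunc ℂ) ^ n = 1 := h
  have h2 : (Polynomial.X : Polynomial ℂ) ^ n = 1 := by
    apply RatFunc.algebraMap_injective ℂ
    simpa using h'
  have h3 := congrArg Polynomial.natDegree h2
  simp at h3
  exact hn h3

/-- The functional equation `Ψ_q(qY) = (1 + Y) Ψ_q(q⁻¹Y)`, for the inverse series. -/
theorem dilogInv_functional :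
    PowerSeries.rescale q0⁻¹ dilogInv =
      (1 + PowerSeries.X) * PowerSeries.rescale q0 dilogInv := by
  have hq : q0 ≠ 0 := q0_ne_zero
  ext n
  rw [add_mul, one_mul, map_add]
  cases n with
  | zero => simp
  | succ n =>
    rw [PowerSeries.coeff_succ_X_mul]
    simp only [PowerSeries.coeff_rescale, dilogInv, PowerSeries.coeff_mk]
    have h1 : ∀ m, qPoch (q0 ^ 2) (q0 ^ 2) m ≠ 0 := fun m => by
      rw [qPoch, Finset.prod_ne_zero_iff]
      intro k _ h
      exact q0_pow_ne_one (2 * k + 2) (by omega) (by rw [pow_add, pow_mul]; exact (sub_eq_zero.mp h).symm)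
    have h2 : qPoch (q0 ^ 2) (q0 ^ 2) (n + 1)
        = qPoch (q0 ^ 2) (q0 ^ 2) n * (1 - (q0 ^ 2) ^ n * q0 ^ 2) := by
      simp [qPoch, Finset.prod_range_succ]
    have h3 := h1 (n + 1)
    rw [h2] at h3 ⊢
    have h4 := right_ne_zero_of_mul h3
    have h5 := h1 n
    have h6 : q0 ^ ((n + 1) ^ 2) = q0 ^ (n ^ 2) * (q0 ^ n) ^ 2 * q0 := by ring
    have h7 : (q0 ^ 2) ^ n = (q0 ^ n) ^ 2 := by ring
    have h8 : q0 ^ n ≠ 0 := pow_ne_zero n hq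
    rw [h6, inv_pow, pow_succ q0 n]
    rw [h7] at h4 ⊢
    generalize q0 ^ n = x at *
    field_simp
    ring

/-- The value `Ψ_q(y)` at a Laurent series `y` of positive `t`-adic valuation. -/
def dilogVal (y : Lqt) : Lqt :=
  (∑' n : ℕ, HahnSeries.C (PowerSeries.coeff n dilogInv) * y ^ n)⁻¹

/-! ### The quantum torus acting on functions on `ℤ³`

A function is written in the coordinates `j' = (j_{23}, j_{13}, j_{12})`. -/

/-- Functions on `ℤ³` with values in `ℂ(q)((t))`. -/
abbrev Fun3 : Type := (Fin 3 → ℤ) → Lqt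

/-- The power `U_{bc}^n`: `(U_{bc} f)(m) = q^{m_{bc}} f(m)`. -/
def U (a : Fin 3) (n : ℤ) : Module.End Lqt Fun3 where
  toFun f := fun m => qL ^ (n * m a) * f m
  map_add' f g := by ext1 m; simp [mul_add]
  map_smul' c f := by ext1 m; simp [mul_left_comm]

/-- The power `V_{bc}^n`: `(V_{bc} f)(m) = f(m - δ_{bc})`. -/
def V (a : Fin 3) (n : ℤ) : Module.End Lqt Fun3 where
  toFun f := fun m => f (m - Pi.single a n)
  map_add' f g := by ext1 m; simp
  map_smul' c f := by ext1 m; simp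

/-- The action of `Y_{-e_7}`, inverse to that of `Y_{e_7} = -q t⁻¹ V_{12} V_{13} V_{23}`. -/
def Y7 : Module.End Lqt Fun3 :=
  (-(qL⁻¹ * tL)) • (V 0 (-1) * V 1 (-1) * V 2 (-1))

/-- The action of `Y_{-e_1}, Y_{-e_3}, Y_{-e_5}` (for `a = 0, 1, 2`): the square of `-i U V`, the
inverse of `Y_{e/2} = i V⁻¹ U⁻¹`. -/
def Yodd (a : Fin 3) : Module.End Lqt Fun3 :=
  ((-iL) • (U a 1 * V a 1)) ^ 2

/-- The action of `Y_{-e_1-e_7}, Y_{-e_3-e_7}, Y_{-e_5-e_7}`, from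
`Y_{λ+μ} = q^{(λ,μ)} Y_λ Y_μ` and `(e_1,e_7) = (e_3,e_7) = (e_5,e_7) = 1`. -/
def Ypair (a : Fin 3) : Module.End Lqt Fun3 :=
  qL • (Yodd a * Y7)

/-- The action of `Y_{-e_1-e_3-e_5-2e_7}`. -/
def Ytop : Module.End Lqt Fun3 :=
  qL ^ 6 • (Yodd 0 * Yodd 1 * Yodd 2 * Y7 ^ 2)

theorem qL_ne_zero : qL ≠ 0 := by
  simpa [qL] using q0_ne_zero

theorem iL_sq : iL ^ 2 = -1 := by
  rw [iL, ← map_pow, i0_sq, map_neg, map_one]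

theorem Y7_apply (f : Fun3) (m : Fin 3 → ℤ) :
    Y7 f m = -(qL⁻¹ * tL) * f (fun a => m a + 1) := by
  have : (m + Pi.single 0 1 + Pi.single 1 1 + Pi.single 2 1 : Fin 3 → ℤ) = fun a => m a + 1 := by
    ext a; fin_cases a <;> simp
  simp only [Y7, V, LinearMap.smul_apply, Module.End.mul_apply, LinearMap.coe_mk, AddHom.coe_mk,
    Pi.smul_apply, smul_eq_mul, sub_neg_eq_add, ← this, Pi.single_neg]

theorem Yodd_apply (a : Fin 3) (f : Fun3) (m : Fin 3 → ℤ) :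
    Yodd a f m = -qL ^ (2 * m a - 1) * f (m - Pi.single a 2) := by
  have h0 := qL_ne_zero
  have h : m - Pi.single a 1 - Pi.single a 1 = m - Pi.single a (2 : ℤ) := by
    rw [sub_sub, ← Pi.single_add]; rfl
  simp only [Yodd, U, V, pow_two, LinearMap.smul_apply, Module.End.mul_apply, LinearMap.coe_mk,
    AddHom.coe_mk, Pi.smul_apply, smul_eq_mul, h, one_mul, Pi.sub_apply, Pi.single_eq_same]
  have h3 : qL ^ (2 * m a - 1) = qL ^ m a * qL ^ (m a - 1) := by
    rw [← zpow_add₀ h0]; congr 1; ring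
  rw [h3]
  linear_combination (qL ^ m a * qL ^ (m a - 1) * f (m - Pi.single a 2)) * iL_sq

theorem Ypair_apply (a : Fin 3) (f : Fun3) (m : Fin 3 → ℤ) :
    Ypair a f m = qL ^ (2 * m a - 1) * tL * f (fun b => m b + 1 - (Pi.single a 2 : Fin 3 → ℤ) b) := by
  have h0 := qL_ne_zero
  have h : (fun b => (m - Pi.single a 2 : Fin 3 → ℤ) b + 1)
      = fun b => m b + 1 - (Pi.single a 2 : Fin 3 → ℤ) b := by
    ext b; simp only [Pi.sub_apply]; ring
  simp only [Ypair, LinearMap.smul_apply, Module.End.mul_apply, Pi.smul_apply, smul_eq_mul,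
    Yodd_apply, Y7_apply, h]
  field_simp

theorem Ytop_apply (f : Fun3) (m : Fin 3 → ℤ) :
    Ytop f m = -qL ^ (1 + 2 * ∑ a, m a) * tL ^ 2 * f m := by
  have h0 := qL_ne_zero
  have h : (fun a => (m - Pi.single 0 2 - Pi.single 1 2 - Pi.single 2 2 : Fin 3 → ℤ) a + 1 + 1)
      = m := by
    ext a; fin_cases a <;> simp <;> ring
  simp only [Ytop, LinearMap.smul_apply, Module.End.mul_apply, Pi.smul_apply, smul_eq_mul,
    Yodd_apply, Y7_apply, pow_two Y7, h]
  have h3 : qL ^ (1 + 2 * ∑ a, m a)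
      = qL ^ (4 : ℕ) * (qL ^ (2 * m 0 - 1) * qL ^ (2 * m 1 - 1) * qL ^ (2 * m 2 - 1)) := by
    rw [← zpow_natCast, ← zpow_add₀ h0, ← zpow_add₀ h0, ← zpow_add₀ h0, Fin.sum_univ_three]
    congr 1; push_cast; ring
  rw [h3]
  simp
  field_simp

/-- The action of `Ψ_q(Y)⁻¹` for an operator `Y`; at each point the series is summed in the
`t`-adic topology. -/
def dilogInvOp (Y : Module.End Lqt Fun3) (f : Fun3) : Fun3 := fun m =>
  ∑' n : ℕ, HahnSeries.C (PowerSeries.coeff n dilogInv) * (Y ^ n) f m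

/-- The action of `Ψ_γ⁻¹`, where `Ψ_γ` is the product
`Ψ_q(Y_{-e_1-e_3-e_5-2e_7}) Ψ_q(Y_{-e_5-e_7}) Ψ_q(Y_{-e_3-e_7}) Ψ_q(Y_{-e_1-e_7}) Ψ_q(Y_{-e_7})`. -/
def psiGammaInv (f : Fun3) : Fun3 :=
  dilogInvOp Y7 <| dilogInvOp (Ypair 0) <| dilogInvOp (Ypair 1) <| dilogInvOp (Ypair 2) <|
    dilogInvOp Ytop f

/-! ### The genus two eigenfunctions -/

open Classical in
/-- The function `g_l`, as a function of `m = j'`, so that `j = unprime m`. It vanishes unless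
`j ∈ ℤ_{≥0}³` and `(l - j)/2 ∈ ℤ_{≥0}³`, and then equals
`Ψ_q(-q t²) (q² t⁻¹)^{(|j|+|l|)/2} ∏_a (q^{-2 l_a};q²)_{(j_a+l_a)/2} (t²;q²)_{(j_a+l_a)/2}`. -/
def g (l : Fin 3 → ℕ) : Fun3 := fun m =>
  let j : Fin 3 → ℤ := unprime m
  if ∀ a, 0 ≤ j a ∧ j a ≤ l a ∧ 2 ∣ (l a : ℤ) - j a then
    dilogVal (-qL * tL ^ 2) * (qL ^ 2 * tL⁻¹) ^ ((∑ a, j a + ∑ a, (l a : ℤ)) / 2) *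
      ∏ a, (qPoch (qL ^ (-2 * (l a : ℤ))) (qL ^ 2) ((j a + l a) / 2).toNat
        * qPoch (tL ^ 2) (qL ^ 2) ((j a + l a) / 2).toNat)
  else 0

/-- The Whittaker polynomial `W_n(x_{bc}; q²) = ∑_{k=0}^n binom(n,k)_{q²} x_{bc}^{n-2k}`. -/
def W (a : Fin 3) (n : ℕ) : AddMonoidAlgebra Lqt (Fin 3 → ℤ) :=
  ∑ k ∈ Finset.range (n + 1),
    AddMonoidAlgebra.single (Pi.single a ((n : ℤ) - 2 * k)) (qBinom (qL ^ 2) n k)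

/-- The eigenfunction `φ_l = W̃(Ψ_γ⁻¹ g_l)`, where
`W̃(f) = ∑_{m ∈ ℤ_{≥0}³} f(m) ∏ W_{m_{bc}}(x_{bc}) / (q²;q²)_{m_{bc}}`. -/
def phi (l : Fin 3 → ℕ) : AddMonoidAlgebra Lqt (Fin 3 → ℤ) :=
  ∑ᶠ m : Fin 3 → ℕ, psiGammaInv (g l) (fun a => (m a : ℤ)) •
    ∏ a, (qPoch (qL ^ 2) (qL ^ 2) (m a))⁻¹ • W a (m a)

end GenusTwo

end

noncomputable section
namespace GenusTwo

/-! ### Triples -/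

/-! Both coefficients are extremal, so a single term produces each of them.

In the lattice sum, the index `k` carries the exponent `l' - 2k'`, which is `l'` only for `k = 0`.
There `Delta_zero` leaves one point, whose weight is `K0 l`.

In `phi l`, a product of Whittaker polynomials `W_m` has exponents `m - 2k` with `k ≥ 0`, so
reaching `l'` needs `m ≥ l'` componentwise. On the other hand `Ψ_γ⁻¹ g_l` vanishes unless `unprime m
≤ l` (`vanishesBeyond_psiGammaInv`). Since `unprime l' = l`, only `m = l'` survives. At that top
point the operators of four of the five dilogarithms evaluate their argument beyond `l`, so these
dilogarithms act as `1` (`psiGammaInv_top`). The fifth operator, `Ytop`, is diagonal, and its series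
sums to `Ψ_q(-q^{2N+1} t²)⁻¹` with `N = (l_1 + l_2 + l_3)/2`. Against the prefactor `Ψ_q(-q t²)` of
`g_l`, this telescopes to `1/(q²t²;q²)_N` (`dilogAt_telescope`), the denominator of `K0`. -/

theorem two_mul_prime {l : Fin 3 → ℕ} (hl : Admissible l) (a : Fin 3) :
    2 * prime l a = twicePrime l a := by
  obtain ⟨s, hs⟩ := hl.even_sum
  rw [Fin.sum_univ_three] at hs
  unfold prime twicePrime
  fin_cases a <;> simp <;> omega

theorem unprime_prime {l : Fin 3 → ℕ} (hl : Admissible l) (a : Fin 3) :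
    unprime (prime l) a = (l a : ℤ) := by
  have h0 := two_mul_prime hl 0
  have h1 := two_mul_prime hl 1
  have h2 := two_mul_prime hl 2
  unfold twicePrime at h0 h1 h2
  simp only [unprime]
  fin_cases a <;> simp at * <;> omega

theorem prime_nonneg {l : Fin 3 → ℕ} (hl : Admissible l) (a : Fin 3) : 0 ≤ prime l a := by
  have h := two_mul_prime hl a
  have h' := hl.triangle a
  unfold twicePrime at h
  omega

theorem two_mul_sum_prime {l : Fin 3 → ℕ} (hl : Admissible l) :
    2 * ∑ a, prime l a = ((∑ a, l a : ℕ) : ℤ) := by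
  have h0 := unprime_prime hl 0
  have h1 := unprime_prime hl 1
  have h2 := unprime_prime hl 2
  simp only [unprime] at h0 h1 h2
  simp only [Fin.sum_univ_three]
  simp at *
  omega

/-- Adding two of the equations gives `2 k_a = 0`. -/
theorem twicePrime_eq_zero {k : Fin 3 → ℕ} (h : ∀ a, twicePrime k a = 0) : k = 0 := by
  have h0 := h 0
  have h1 := h 1
  have h2 := h 2
  simp only [twicePrime] at h0 h1 h2
  ext a
  fin_cases a <;> simp at * <;> omega

/-- The chain `0 ≤ r_a ≤ n_a ≤ -s` forces everything to vanish. That `0` itself qualifies is `l' ≥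
0`, the triangle inequality. -/
theorem Delta_zero {l : Fin 3 → ℕ} (hl : Admissible l) : Delta 0 l = {0} := by
  ext ⟨r, s, n⟩
  simp only [Delta, Set.mem_ofPred_eq, Set.mem_singleton_iff, Prod.mk_eq_zero, Pi.zero_apply]
  constructor
  · rintro ⟨-, h⟩
    have h0 := h 0
    have h1 := h 1
    have h2 := h 2
    simp only [unprime] at h0 h1 h2
    refine ⟨?_, by simp at *; omega, ?_⟩ <;> ext a <;> fin_cases a <;> simp at * <;> omega
  · rintro ⟨rfl, rfl, rfl⟩
    refine ⟨fun a => ?_, fun a => ?_⟩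
    · have := prime_nonneg hl a
      simp [twicePrime]
      omega
    · simp [unprime]

/-! ### Coefficients of finite sums in a monoid algebra -/

/-- The coefficient of a monomial, as an additive homomorphism. -/
def coeffHom {K M : Type*} [Semiring K] (p : M) : AddMonoidAlgebra K M →+ K where
  toFun x := x.coeff p
  map_zero' := rfl
  map_add' _ _ := rfl

/-! ### The lattice sum -/

theorem weight_zero (l : Fin 3 → ℕ) : weight l 0 0 0 0 = K0 l := by
  have hs : ((∑ a, (l a : ℤ)) / 2).toNat = (∑ a, l a) / 2 := by
    rw [← Nat.cast_sum]; omega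
  have hp : (qK ^ 2 * tK⁻¹) ^ (∑ a, (l a : ℤ))
      = tK ^ (-((∑ a, l a : ℕ) : ℤ)) * qK ^ (2 * ∑ a, l a) := by
    rw [mul_zpow, inv_zpow, ← zpow_neg, mul_comm, ← Nat.cast_sum, zpow_natCast, pow_mul]
  simp only [weight, K0]
  simp [unprime, twicePrime, hs, hp, qPoch]

theorem coeff_phiSum {l : Fin 3 → ℕ} (hl : Admissible l) :
    (phiSum l).coeff (prime l) = K0 l := by
  have hfin : {k : Fin 3 → ℕ | ∑ a, k a ≤ ∑ a, l a}.Finite := by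
    refine (Set.finite_Iic (fun _ => ∑ a, l a)).subset fun k hk a => ?_
    exact (Finset.single_le_sum (fun _ _ => Nat.zero_le _) (Finset.mem_univ a)).trans hk
  change coeffHom (prime l) (phiSum l) = _
  have hterm : ∀ k : Fin 3 → ℕ, coeffHom (prime l) (∑ᶠ p ∈ Delta k l,
      AddMonoidAlgebra.single (fun a => prime l a - twicePrime k a)
        (weight l k p.1 p.2.1 p.2.2)) = if k = 0 then K0 l else 0 := by
    intro k
    rw [AddMonoidHom.map_finsum_mem _ _ (Delta_finite k l)]
    split_ifs with hk
    · subst hk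
      rw [Delta_zero hl, finsum_mem_singleton]
      rw [← weight_zero]
      change (AddMonoidAlgebra.single _ _ : AddMonoidAlgebra Kqt (Fin 3 → ℤ)).coeff _ = _
      simp [twicePrime]
    · refine finsum_mem_eq_zero_of_forall_eq_zero fun p _ => ?_
      refine Finsupp.single_eq_of_ne fun h => hk (twicePrime_eq_zero fun a => ?_)
      have := congrFun h a
      omega
  rw [phiSum, AddMonoidHom.map_finsum_mem _ _ hfin]
  simp only [hterm]
  rw [finsum_eq_single _ 0 (fun k hk => by simp [hk])]
  simp

/-! ### The quantum dilogarithm at `c t²` -/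

open WithZero in
/-- Coefficientwise stabilisation of the partial sums implies `t`-adic convergence. -/
theorem hasSum_of_coeff {ι : Type*} {f : ι → Lqt} {F : Lqt}
    (h : ∀ D : ℤ, ∃ s₀ : Finset ι, ∀ s, s₀ ⊆ s → ∀ n < D, (∑ i ∈ s, f i).coeff n = F.coeff n) :
    HasSum f F := by
  intro u hu
  obtain ⟨γ, hγ⟩ := Valued.mem_nhds.mp hu
  -- Vanishing below degree `D` bounds the valuation by `exp (-D)`, while the neighbourhood asks for
  -- a strict inequality; hence the `- 1`.
  set D := -(log (MonoidWithZeroHom.ValueGroup₀.embedding γ.1) - 1) with hD₀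
  have hD : exp (-D) < MonoidWithZeroHom.ValueGroup₀.embedding γ.1 := by
    rw [← lt_log_iff_exp_lt (by simp), hD₀]
    simp
  obtain ⟨s₀, hs₀⟩ := h D
  refine Filter.mem_map.mpr (Filter.mem_of_superset (Filter.mem_atTop s₀) fun s hs => hγ ?_)
  change Valued.v.restrict _ < γ.1
  rw [Valued.v.restrict_lt_iff_lt_embedding]
  refine lt_of_le_of_lt ((LaurentSeries.valuation_le_iff_coeff_lt_eq_zero Fq).mpr ?_) hD
  intro n hn
  rw [HahnSeries.coeff_sub, sub_eq_zero]
  exact hs₀ s hs n hn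

/-- The Laurent series of `Ψ_q(c t²)⁻¹`. -/
def dilogAt (c : Fq) : Lqt :=
  HahnSeries.ofPowerSeries ℤ Fq (PowerSeries.expand 2 two_ne_zero (PowerSeries.rescale c dilogInv))

theorem coeff_dilogAt_even (c : Fq) (n : ℕ) :
    (dilogAt c).coeff (2 * n) = c ^ n * PowerSeries.coeff n dilogInv := by
  have := HahnSeries.ofPowerSeries_apply_coeff (Γ := ℤ)
    (PowerSeries.expand 2 two_ne_zero (PowerSeries.rescale c dilogInv)) (2 * n)
  rw [PowerSeries.coeff_expand_mul, PowerSeries.coeff_rescale] at this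
  exact_mod_cast this

theorem coeff_dilogAt_of_ne (c : Fq) (k : ℤ) (hk : ∀ n : ℕ, k ≠ 2 * n) :
    (dilogAt c).coeff k = 0 := by
  rw [dilogAt, PowerSeries.coeff_coe]
  split_ifs with h
  · rfl
  · apply PowerSeries.coeff_expand_of_not_dvd
    rintro ⟨n, hn⟩
    exact hk n (by omega)

theorem dilog_term (a c : Fq) (n : ℕ) :
    (HahnSeries.C a * (HahnSeries.C c * tL ^ 2) ^ n : Lqt)
      = HahnSeries.single (2 * n : ℤ) (c ^ n * a) := by
  rw [mul_pow, ← map_pow, ← pow_mul, tL, HahnSeries.single_pow, ← mul_assoc, ← map_mul,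
    HahnSeries.C_apply, HahnSeries.single_mul_single]
  simp [mul_comm]

theorem hasSum_dilogAt (c : Fq) :
    HasSum (fun n : ℕ => HahnSeries.C (PowerSeries.coeff n dilogInv)
      * (HahnSeries.C c * tL ^ 2) ^ n) (dilogAt c) := by
  -- The term of index `n` lives in degree `2n`, so indices `n ≥ D` do not affect degrees below `D`.
  refine hasSum_of_coeff fun D => ⟨Finset.range D.toNat, fun s hs k hk => ?_⟩
  simp only [dilog_term]
  rw [HahnSeries.coeff_sum]
  by_cases hk2 : ∃ n : ℕ, k = 2 * n
  · obtain ⟨n, rfl⟩ := hk2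
    rw [coeff_dilogAt_even, Finset.sum_eq_single n]
    · simp
    · intro b _ hb
      exact HahnSeries.coeff_single_of_ne (by omega)
    · intro hn
      exact absurd (hs (Finset.mem_range.mpr (by omega))) hn
  · push Not at hk2
    rw [coeff_dilogAt_of_ne c k hk2]
    exact Finset.sum_eq_zero fun b _ => HahnSeries.coeff_single_of_ne (hk2 b)

theorem dilogAt_ne_zero (c : Fq) : dilogAt c ≠ 0 := by
  intro h
  have h0 := coeff_dilogAt_even c 0
  rw [h, PowerSeries.coeff_zero_eq_constantCoeff_apply, constantCoeff_dilogInv] at h0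
  simp at h0

/-- The functional equation of `dilogInv` under the substitution `X ↦ c t²`. -/
theorem dilogAt_functional (c : Fq) :
    dilogAt (q0⁻¹ * c) = (1 + HahnSeries.C c * tL ^ 2) * dilogAt (q0 * c) := by
  have h := congrArg (fun f => HahnSeries.ofPowerSeries ℤ Fq
    (PowerSeries.expand 2 two_ne_zero (PowerSeries.rescale c f))) dilogInv_functional
  simp only [PowerSeries.rescale_rescale, map_mul, map_add, map_one, PowerSeries.rescale_X,
    PowerSeries.expand_C, PowerSeries.expand_X, map_pow, HahnSeries.ofPowerSeries_C,
    HahnSeries.ofPowerSeries_X] at h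
  exact h

theorem dilogAt_telescope (N : ℕ) :
    dilogAt (-q0) = qPoch (qL ^ 2 * tL ^ 2) (qL ^ 2) N * dilogAt (-q0 ^ (2 * N + 1)) := by
  induction N with
  | zero => simp [qPoch]
  | succ N ih =>
    have hq := q0_ne_zero
    -- This argument moves `-q^{2N+1}` to `-q^{2N+3}` and releases `1 - q^{2N+2} t²`, the next
    -- factor of the Pochhammer symbol.
    have h := dilogAt_functional (-q0 ^ (2 * N + 2))
    have e1 : q0⁻¹ * -q0 ^ (2 * N + 2) = -q0 ^ (2 * N + 1) := by
      rw [pow_succ q0 (2 * N + 1)]; field_simp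
    have e2 : q0 * -q0 ^ (2 * N + 2) = -q0 ^ (2 * (N + 1) + 1) := by ring
    rw [e1, e2] at h
    rw [ih, h, qPoch, qPoch, Finset.prod_range_succ]
    simp only [qL, map_neg, map_pow]
    ring

theorem dilogVal_neg_q_t_sq : dilogVal (-qL * tL ^ 2) = (dilogAt (-q0))⁻¹ := by
  rw [dilogVal, ← (hasSum_dilogAt (-q0)).tsum_eq]
  simp [qL]

/-! ### Functions vanishing beyond a triple -/

/-- `f` vanishes unless `j = unprime m` satisfies `j ≤ l`. -/
def VanishesBeyond (l : Fin 3 → ℕ) (f : Fun3) : Prop :=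
  ∀ m, (∃ a, (l a : ℤ) < unprime m a) → f m = 0

/-- `Y` multiplies by a function after a shift which increases `j` by `d`. -/
def RaisesBy (Y : Module.End Lqt Fun3) (d : Fin 3 → ℤ) : Prop :=
  ∀ f m, ∃ (c : Lqt) (m' : Fin 3 → ℤ), Y f m = c * f m' ∧ ∀ a, unprime m' a = unprime m a + d a

theorem RaisesBy.vanishesBeyond {Y : Module.End Lqt Fun3} {d : Fin 3 → ℤ} (hY : RaisesBy Y d)
    (hd : 0 ≤ d) {l : Fin 3 → ℕ} {f : Fun3} (hf : VanishesBeyond l f) :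
    VanishesBeyond l (Y f) := by
  rintro m ⟨a, ha⟩
  obtain ⟨c, m', h, hm⟩ := hY f m
  rw [h, hf m' ⟨a, by have := hm a; have : 0 ≤ d a := hd a; omega⟩, mul_zero]

theorem RaisesBy.vanishesBeyond_pow {Y : Module.End Lqt Fun3} {d : Fin 3 → ℤ}
    (hY : RaisesBy Y d) (hd : 0 ≤ d) {l : Fin 3 → ℕ} {f : Fun3} (hf : VanishesBeyond l f)
    (n : ℕ) : VanishesBeyond l ((Y ^ n) f) := by
  induction n with
  | zero => simpa using hf
  | succ n ih =>
    rw [pow_succ']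
    exact hY.vanishesBeyond hd ih

/-- Every term of the series is zero there, so no convergence is needed. -/
theorem RaisesBy.vanishesBeyond_dilogInvOp {Y : Module.End Lqt Fun3} {d : Fin 3 → ℤ}
    (hY : RaisesBy Y d) (hd : 0 ≤ d) {l : Fin 3 → ℕ} {f : Fun3} (hf : VanishesBeyond l f) :
    VanishesBeyond l (dilogInvOp Y f) := by
  intro m hm
  simp [dilogInvOp, hY.vanishesBeyond_pow hd hf _ m hm]

/-- At the top of the support only the constant term of the dilogarithm contributes. -/
theorem RaisesBy.dilogInvOp_top {Y : Module.End Lqt Fun3} {d : Fin 3 → ℤ}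
    (hY : RaisesBy Y d) (hd : 0 ≤ d) {b : Fin 3} (hb : 0 < d b) {l : Fin 3 → ℕ} {f : Fun3}
    (hf : VanishesBeyond l f) {m : Fin 3 → ℤ} (hm : ∀ a, unprime m a = l a) :
    dilogInvOp Y f m = f m := by
  rw [dilogInvOp, tsum_eq_single 0]
  · rw [PowerSeries.coeff_zero_eq_constantCoeff_apply, constantCoeff_dilogInv]
    simp
  · intro n hn
    -- The outermost `Y` already moves the evaluation point past `l` in direction `b`, and `Y ^ n f`
    -- still vanishes there.
    obtain ⟨n, rfl⟩ := Nat.exists_eq_succ_of_ne_zero hn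
    obtain ⟨c, m', h, hm'⟩ := hY ((Y ^ n) f) m
    rw [Nat.succ_eq_add_one, pow_succ', Module.End.mul_apply, h,
      hY.vanishesBeyond_pow hd hf n m' ⟨b, by rw [hm', hm]; omega⟩, mul_zero, mul_zero]

theorem raisesBy_Y7 : RaisesBy Y7 (fun _ => 2) := fun f m =>
  ⟨_, _, Y7_apply f m, fun a => by simp only [unprime]; ring⟩

theorem raisesBy_Ypair (a : Fin 3) : RaisesBy (Ypair a) (Pi.single a 2) := fun f m =>
  ⟨_, _, Ypair_apply a f m, fun b => by
    simp only [unprime]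
    fin_cases a <;> fin_cases b <;> simp <;> ring⟩

/-- The shift is zero: vanishing is preserved, but `RaisesBy.dilogInvOp_top` does not apply, so the
whole series must be summed. -/
theorem raisesBy_Ytop : RaisesBy Ytop 0 := fun f m =>
  ⟨_, _, Ytop_apply f m, fun a => by simp⟩

theorem Ytop_pow_apply (f : Fun3) (m : Fin 3 → ℤ) (n : ℕ) :
    (Ytop ^ n) f m = (-qL ^ (1 + 2 * ∑ a, m a) * tL ^ 2) ^ n * f m := by
  induction n with
  | zero => simp
  | succ n ih => rw [pow_succ', Module.End.mul_apply, Ytop_apply, ih]; ring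

theorem dilogInvOp_Ytop (f : Fun3) (m : Fin 3 → ℤ) (N : ℕ) (hN : ∑ a, m a = N) :
    dilogInvOp Ytop f m = dilogAt (-q0 ^ (2 * N + 1)) * f m := by
  rw [dilogInvOp]
  have h : -qL ^ (1 + 2 * ∑ a, m a) = HahnSeries.C (-q0 ^ (2 * N + 1)) := by
    rw [hN, map_neg, map_pow, ← qL, ← zpow_natCast]
    congr 2
    push_cast
    ring
  simp only [Ytop_pow_apply, h, ← mul_assoc]
  exact ((hasSum_dilogAt _).mul_right (f m)).tsum_eq

theorem vanishesBeyond_g (l : Fin 3 → ℕ) : VanishesBeyond l (g l) := by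
  rintro m ⟨a, ha⟩
  simp only [g]
  rw [if_neg]
  intro h
  have := (h a).2.1
  omega

theorem vanishesBeyond_psiGammaInv {l : Fin 3 → ℕ} {f : Fun3} (hf : VanishesBeyond l f) :
    VanishesBeyond l (psiGammaInv f) := by
  have h7 : (0 : Fin 3 → ℤ) ≤ fun _ => 2 := fun _ => by simp
  have hp : ∀ a, (0 : Fin 3 → ℤ) ≤ Pi.single a 2 := fun a => by simp
  exact raisesBy_Y7.vanishesBeyond_dilogInvOp h7 <|
    (raisesBy_Ypair 0).vanishesBeyond_dilogInvOp (hp 0) <|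
    (raisesBy_Ypair 1).vanishesBeyond_dilogInvOp (hp 1) <|
    (raisesBy_Ypair 2).vanishesBeyond_dilogInvOp (hp 2) <|
    raisesBy_Ytop.vanishesBeyond_dilogInvOp le_rfl hf

/-- The four raising factors are stripped from the outside in; each time the function still inside
vanishes beyond `l`. -/
theorem psiGammaInv_top {l : Fin 3 → ℕ} {f : Fun3} (hf : VanishesBeyond l f) {m : Fin 3 → ℤ}
    (hm : ∀ a, unprime m a = l a) : psiGammaInv f m = dilogInvOp Ytop f m := by
  have h7 : (0 : Fin 3 → ℤ) ≤ fun _ => 2 := fun _ => by simp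
  have hp : ∀ a, (0 : Fin 3 → ℤ) ≤ Pi.single a 2 := fun a => by simp
  have v3 := raisesBy_Ytop.vanishesBeyond_dilogInvOp le_rfl hf
  have v2 := (raisesBy_Ypair 2).vanishesBeyond_dilogInvOp (hp 2) v3
  have v1 := (raisesBy_Ypair 1).vanishesBeyond_dilogInvOp (hp 1) v2
  have v0 := (raisesBy_Ypair 0).vanishesBeyond_dilogInvOp (hp 0) v1
  rw [psiGammaInv, raisesBy_Y7.dilogInvOp_top h7 (b := 0) (by simp) v0 hm,
    (raisesBy_Ypair 0).dilogInvOp_top (hp 0) (b := 0) (by simp) v1 hm,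
    (raisesBy_Ypair 1).dilogInvOp_top (hp 1) (b := 1) (by simp) v2 hm,
    (raisesBy_Ypair 2).dilogInvOp_top (hp 2) (b := 2) (by simp) v3 hm]

theorem g_top {l : Fin 3 → ℕ} (hl : Admissible l) :
    g l (prime l) = (dilogAt (-q0))⁻¹ * (qL ^ 2 * tL⁻¹) ^ (∑ a, l a) *
      ∏ a, (qPoch (qL ^ (-2 * (l a : ℤ))) (qL ^ 2) (l a) * qPoch (tL ^ 2) (qL ^ 2) (l a)) := by
  have h1 : (∑ a, (l a : ℤ) + ∑ a, (l a : ℤ)) / 2 = ((∑ a, l a : ℕ) : ℤ) := by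
    push_cast; omega
  have h2 : ∀ a, ((l a + l a : ℤ) / 2).toNat = l a := fun a => by omega
  simp only [g, unprime_prime hl, h1, h2, zpow_natCast, dilogVal_neg_q_t_sq]
  rw [if_pos]
  simp

/-! ### The Whittaker polynomials -/

theorem coeff_prod_W (m : Fin 3 → ℕ) (p : Fin 3 → ℤ) :
    (∏ a, W a (m a)).coeff p = ∑ k ∈ Fintype.piFinset fun a => Finset.range (m a + 1),
      if (fun a => (m a : ℤ) - 2 * k a) = p then ∏ a, qBinom (qL ^ 2) (m a) (k a) else 0 := by
  have hs : ∀ v : Fin 3 → ℤ, ∀ c : Fin 3 → Lqt,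
      ∏ a, AddMonoidAlgebra.single (Pi.single a (v a) : Fin 3 → ℤ) (c a)
        = AddMonoidAlgebra.single v (∏ a, c a) := by
    intro v c
    rw [Fin.prod_univ_three, Fin.prod_univ_three, AddMonoidAlgebra.single_mul_single,
      AddMonoidAlgebra.single_mul_single]
    congr 1
    ext a
    fin_cases a <;> simp
  simp only [W]
  rw [Finset.prod_univ_sum, AddMonoidAlgebra.coeff_sum, Finsupp.finsetSum_apply]
  refine Finset.sum_congr rfl fun k _ => ?_
  rw [hs (fun a => (m a : ℤ) - 2 * k a), AddMonoidAlgebra.coeff_single, Finsupp.single_apply]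

theorem qPoch_q_sq_ne_zero (n : ℕ) : qPoch (qL ^ 2) (qL ^ 2) n ≠ 0 := by
  rw [qPoch, Finset.prod_ne_zero_iff]
  intro k _ h
  refine q0_pow_ne_one (2 * k + 2) (by omega) ((HahnSeries.C_injective (Γ := ℤ)) ?_)
  rw [map_pow, map_one, ← qL, pow_add, pow_mul]
  exact (sub_eq_zero.mp h).symm

theorem coeff_prod_W_self (m : Fin 3 → ℕ) :
    (∏ a, W a (m a)).coeff (fun a => (m a : ℤ)) = 1 := by
  rw [coeff_prod_W, Finset.sum_eq_single 0]
  · have : ∀ n, qBinom (qL ^ 2) n 0 = 1 := fun n => by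
      simp [qBinom, qPoch_q_sq_ne_zero, show qPoch (qL ^ 2) (qL ^ 2) 0 = 1 from rfl]
    simp [this]
  · intro k _ hk
    rw [if_neg]
    intro h
    refine hk (funext fun a => ?_)
    have := congrFun h a
    simp; omega
  · simp [Fintype.mem_piFinset]

theorem coeff_phi {l : Fin 3 → ℕ} (hl : Admissible l) :
    (phi l).coeff (prime l) = toL (K0 l) := by
  set m₀ : Fin 3 → ℕ := fun a => (prime l a).toNat with hm₀
  have hcast : (fun a => (m₀ a : ℤ)) = prime l := by
    ext a
    have := prime_nonneg hl a
    simp only [hm₀]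
    omega
  have hv := vanishesBeyond_psiGammaInv (vanishesBeyond_g l)
  -- Finite support lets the coefficient pass through `finsum`. It holds because `m ≥ 0` and
  -- `unprime m ≤ l` bound `m`.
  have hfin : (Function.support fun m : Fin 3 → ℕ => psiGammaInv (g l) (fun a => (m a : ℤ)) •
      ∏ a, (qPoch (qL ^ 2) (qL ^ 2) (m a))⁻¹ • W a (m a)).Finite := by
    refine (Set.finite_Iic (fun _ => ∑ a, l a)).subset fun m hm => ?_
    by_contra hcon
    refine hm ?_
    simp only
    rw [hv, zero_smul]
    by_contra! hle
    refine hcon fun b => ?_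
    have h0 := hle 0
    have h1 := hle 1
    have h2 := hle 2
    simp only [unprime, Fin.sum_univ_three] at *
    fin_cases b <;> simp at * <;> omega
  have hcoeff : ∀ m : Fin 3 → ℕ, coeffHom (prime l) (psiGammaInv (g l) (fun a => (m a : ℤ)) •
      ∏ a, (qPoch (qL ^ 2) (qL ^ 2) (m a))⁻¹ • W a (m a))
      = psiGammaInv (g l) (fun a => (m a : ℤ)) * ((∏ a, (qPoch (qL ^ 2) (qL ^ 2) (m a))⁻¹) *
        (∏ a, W a (m a)).coeff (prime l)) := by
    intro m
    rw [Finset.prod_smul]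
    rfl
  change coeffHom (prime l) (phi l) = _
  rw [phi, AddMonoidHom.map_finsum _ hfin]
  simp only [hcoeff]
  rw [finsum_eq_single _ m₀]
  · obtain ⟨N, hN⟩ := hl.even_sum
    have hsum : ∑ a, prime l a = N := by
      have := two_mul_sum_prime hl
      omega
    have hNdiv : (∑ a, l a) / 2 = N := by omega
    have hpoch : ∀ (X p : Kqt) (n : ℕ), toL (qPoch X p n) = qPoch (toL X) (toL p) n := by
      intro X p n
      simp [qPoch]
    have hW := coeff_prod_W_self m₀
    rw [hcast] at hW ⊢
    rw [hW, psiGammaInv_top (vanishesBeyond_g l) (unprime_prime hl), dilogInvOp_Ytop _ _ N hsum,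
      g_top hl, K0, hNdiv]
    simp only [map_mul, map_div₀, map_prod, hpoch, map_pow, map_zpow₀, toL_qK, toL_tK]
    -- This series occurs once from `Ytop` and once inverted from `g_l` after telescoping; being
    -- nonzero, it cancels.
    have hE := dilogAt_ne_zero (-q0 ^ (2 * N + 1))
    rw [dilogAt_telescope N]
    simp only [Finset.prod_mul_distrib, Finset.prod_div_distrib, Finset.prod_inv_distrib,
      zpow_neg, zpow_natCast, mul_pow, inv_pow, pow_mul, hm₀]
    rw [mul_inv]
    field_simp
  · intro m hm
    by_cases hW : (∏ a, W a (m a)).coeff (prime l) = 0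
    · rw [hW, mul_zero, mul_zero]
    rw [coeff_prod_W] at hW
    obtain ⟨k, -, hk⟩ := Finset.exists_ne_zero_of_sum_ne_zero hW
    have hk' : (fun a => (m a : ℤ) - 2 * k a) = prime l := by
      by_contra h
      exact hk (if_neg h)
    -- If `unprime m ≤ l`, then `m = l' + 2k` and `unprime l' = l` give `k_b + k_c ≤ 0` for each
    -- pair. Hence `k = 0` and `m = m₀`, which is excluded.
    rw [hv, zero_mul]
    by_contra! hle
    refine hm (funext fun b => ?_)
    have e := congrFun hk'
    have h0 := hle 0
    have h1 := hle 1
    have h2 := hle 2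
    have u0 := unprime_prime hl 0
    have u1 := unprime_prime hl 1
    have u2 := unprime_prime hl 2
    have e0 := e 0
    have e1 := e 1
    have e2 := e 2
    have ec := congrFun hcast b
    simp only [unprime] at *
    fin_cases b <;> simp at * <;> omega

end GenusTwo

end

theorem mainTheorem3 (l : Fin 3 → ℕ) (hl : GenusTwo.Admissible l) :
    GenusTwo.Delta 0 l = {0} ∧
    (GenusTwo.phi l).coeff (GenusTwo.prime l) =
      GenusTwo.toL (GenusTwo.K0 l) ∧
    (GenusTwo.phiSum l).coeff (GenusTwo.prime l) = GenusTwo.K0 l :=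
  ⟨GenusTwo.Delta_zero hl, GenusTwo.coeff_phi hl, GenusTwo.coeff_phiSum hl⟩
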